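/- For a sequence $\bar\sigma=(\sigma_k)_{k\ge 0}$, where $\sigma_k$ is a permutation of $\{0,1\}^k$ (so $\sigma_0$ is trivial), define graphs $G_n=G_n(\bar\sigma)$ on the vertex set $\{0,1\}^n$ recursively. $G_0$ is a single isolated vertex. $G_{n+1}$ consists of two copies of $G_n$, on $\{0,1\}^n\times\{0\}$ and on $\{0,1\}^n\times\{1\}$, together with the perfect matching $\{(x,0),(\sigma_n(x),1)\}$, $x\in\{0,1\}^n$. The random duplicube $\boldsymbol G_n$ is $G_n(\bar\sigma)$ where the $\sigma_k$ are independent and each $\sigma_k$ is uniformly distributed on the permutations of $\{0,1\}^k$. Let $D(G)$ denote the diameter of a graph $G$. **Theorem.** With probability at least $1-o(2^{-n})$ as $n\to\infty$, $$D(\boldsymbol G_n)=\frac{n}{\log_2 n}+O\!\left(\frac{n}{\log^2 n}\right).$$ That is, there are an absolute constant $C$ and a sequence $(\varepsilon_n)$ with $2^n\varepsilon_n\to 0$ such that for all $n\ge 2$ $$\mathbb P\left[\,\left|D(\boldsymbol G_n)-\frac{n}{\log_2 n}\right|\le C\,\frac{n}{(\log n)^2}\right]\ \ge\ 1-\varepsilon_n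 .$$ -/

import Mathlib

open Filter Asymptotics MeasureTheory

namespace Duplicube

/-- The `σ`-twist of two graphs `G₀`, `G₁` on the same vertex set `V`: the disjoint union of a copy
of `G₀` on `V × {0}` and a copy of `G₁` on `V × {1}`, together with the perfect matching
`{(x, 0), (σ x, 1)}`, `x ∈ V`. The second component `false` stands for `0`, `true` for `1`. -/
def twist {V : Type*} (G₀ G₁ : SimpleGraph V) (σ : Equiv.Perm V) : SimpleGraph (V × Bool) where
  Adj
    | (x, false), (y, false) => G₀.Adj x y
    | (x, true), (y, true) => G₁.Adj x y
    | (x, false), (y, true) => y = σ x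
    | (x, true), (y, false) => x = σ y
  symm := ⟨by
    rintro ⟨x, _ | _⟩ ⟨y, _ | _⟩ h
    · exact SimpleGraph.Adj.symm (G := G₀) h
    · exact h
    · exact h
    · exact SimpleGraph.Adj.symm (G := G₁) h⟩
  loopless := ⟨by
    rintro ⟨x, _ | _⟩ h
    · exact G₀.loopless.irrefl x h
    · exact G₁.loopless.irrefl x h⟩

/-- Sequences `(σ_k)` where `σ_k` is a permutation of `{0,1}^k`. (`σ_0` is trivial.) -/
abbrev PermSeq : Type := ∀ k : ℕ, Equiv.Perm (Fin k → Bool)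

/-- The `n`-th generation duplicube `G_n(σ)`, a graph on `{0,1}^n`: `G_0` is an isolated vertex and
`G_{n+1}` is the `σ_n`-twist of two identical copies of `G_n`, where
`(x_1, …, x_{n+1}) ∈ {0,1}^{n+1}` is identified with `((x_1, …, x_n), x_{n+1})`. -/
def duplicube (σ : PermSeq) : ∀ n : ℕ, SimpleGraph (Fin n → Bool)
  | 0 => ⊥
  | n + 1 =>
    (twist (duplicube σ n) (duplicube σ n) (σ n)).comap
      fun x : Fin (n + 1) → Bool => (Fin.init x, x (Fin.last n))

/-- The finite set of permutations of `{0,1}^k` carries the discrete `σ`-algebra. -/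
instance instMeasurableSpacePerm (k : ℕ) : MeasurableSpace (Equiv.Perm (Fin k → Bool)) := ⊤

instance instDiscreteMeasurableSpacePerm (k : ℕ) :
    DiscreteMeasurableSpace (Equiv.Perm (Fin k → Bool)) := ⟨fun _ => trivial⟩

/-- The law of the sequence of permutations that defines the random duplicube: the `σ_k` are
independent, and `σ_k` is a uniformly random permutation of `{0,1}^k`. -/
noncomputable def permLaw : Measure PermSeq :=
  Measure.infinitePi fun k : ℕ => (PMF.uniformOfFintype (Equiv.Perm (Fin k → Bool))).toMeasure

instance instIsProbabilityMeasurePermLaw : IsProbabilityMeasure permLaw := by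
  unfold permLaw
  infer_instance

end Duplicube

/-! The lower bound holds for every `σ`: a vertex has at most n neighbours, so a ball of radius r
has at most (n+1)^r vertices. Covering all 2^n vertices forces diameter at least n / log₂(n+1)
(`two_pow_le_succ_pow_diam`).

For the upper bound, balls of G_n are shown to grow by a factor d = ⌊n/64⌋ per step. Vertices are
classified by their prefix of length m = 48d, and only the matchings m, …, n-1 are used. Fix f
vertices with distinct prefixes and a list of t = df prefixes. Since the levels are independent, it
is so unlikely that all these neighbours have prefixes in the list that a union bound over all
choices of vertices and lists succeeds (`permLaw_real_expBad_le`). Expansion thus holds for all sets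
at once, and the exploration of a ball needs no conditioning.

Hence every ball reaches size n·2^(⌊n/2⌋+1) at radius about n / (2 log₂ n). As σ_n is independent of
G_n, a birthday-type estimate shows that it joins every two such balls (`permLaw_real_joinBad_le`),
so the diameter of G_{n+1} is at most twice that radius plus 2 (`diam_succ_le`). -/

namespace Duplicube

/-! ### Coordinates, prefixes and adjacency. -/

/-- The first `k` coordinates of a vertex of `{0,1}^n`. -/
def pre {k n : ℕ} (h : k ≤ n) (x : Fin n → Bool) : Fin k → Bool := fun i => x (Fin.castLE h i)

/-- The vertex of `{0,1}^(n+1)` with first coordinates `x` and last coordinate `a`. -/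
def app {n : ℕ} (x : Fin n → Bool) (a : Bool) : Fin (n + 1) → Bool :=
  Fin.snoc (α := fun _ => Bool) x a

@[simp] lemma init_app {n : ℕ} (x : Fin n → Bool) (a : Bool) :
    (Fin.init (α := fun _ => Bool) (app x a) : Fin n → Bool) = x := by
  simp [app]

@[simp] lemma app_last {n : ℕ} (x : Fin n → Bool) (a : Bool) : app x a (Fin.last n) = a := by
  simp [app]

lemma exists_eq_app {n : ℕ} (u : Fin (n + 1) → Bool) : ∃ x a, u = app x a :=
  ⟨Fin.init u, u (Fin.last n), by simp [app]⟩

lemma pre_self {n : ℕ} (x : Fin n → Bool) : pre le_rfl x = x := rfl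

lemma pre_app {k n : ℕ} (h : k ≤ n) (x : Fin n → Bool) (a : Bool) :
    pre (h.trans n.le_succ) (app x a) = pre h x := by
  funext i
  exact Fin.snoc_castSucc (α := fun _ => Bool) a x (Fin.castLE h i)

lemma pre_pre {j k n : ℕ} (h : j ≤ k) (h' : k ≤ n) (x : Fin n → Bool) :
    pre h (pre h' x) = pre (h.trans h') x := rfl

lemma adj_app_same (σ : PermSeq) {n : ℕ} (x y : Fin n → Bool) (a : Bool) :
    (duplicube σ (n + 1)).Adj (app x a) (app y a) ↔ (duplicube σ n).Adj x y := by
  cases a <;> simp [duplicube, twist]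

lemma adj_app_false_true (σ : PermSeq) {n : ℕ} (x y : Fin n → Bool) :
    (duplicube σ (n + 1)).Adj (app x false) (app y true) ↔ y = σ n x := by
  simp [duplicube, twist]

lemma adj_app_true_false (σ : PermSeq) {n : ℕ} (x y : Fin n → Bool) :
    (duplicube σ (n + 1)).Adj (app x true) (app y false) ↔ x = σ n y := by
  simp [duplicube, twist]

lemma duplicube_congr {σ τ : PermSeq} : ∀ {n : ℕ}, (∀ k < n, σ k = τ k) →
    duplicube σ n = duplicube τ n
  | 0, _ => rfl
  | n + 1, h => by
    rw [duplicube, duplicube, duplicube_congr fun k hk => h k (hk.trans n.lt_succ_self),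
      h n n.lt_succ_self]

/-- Every vertex has a neighbour along the `k`-th matching, whose first `k` coordinates are the
image under `σ k` or its inverse. -/
lemma exists_adj_pre (σ : PermSeq) {k : ℕ} : ∀ {n : ℕ} (hk : k < n) (x : Fin n → Bool),
    ∃ y, (duplicube σ n).Adj x y ∧ pre hk.le y =
      if x ⟨k, hk⟩ then (σ k).symm (pre hk.le x) else σ k (pre hk.le x)
  | 0, hk, _ => absurd hk (Nat.not_lt_zero k)
  | n + 1, hk, u => by
    obtain ⟨x, a, rfl⟩ := exists_eq_app u
    rcases Nat.lt_succ_iff_lt_or_eq.1 hk with h | rfl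
    · obtain ⟨y, hy, hp⟩ := exists_adj_pre σ h x
      refine ⟨app y a, (adj_app_same ..).2 hy, ?_⟩
      have : app x a ⟨k, hk⟩ = x ⟨k, h⟩ := Fin.snoc_castSucc (α := fun _ => Bool) a x ⟨k, h⟩
      rw [pre_app h.le, pre_app h.le, hp, this]
    · have : app x a ⟨k, hk⟩ = a := app_last x a
      rw [this]
      cases a
      · refine ⟨app (σ k x) true, (adj_app_false_true ..).2 rfl, ?_⟩
        simp [pre_app le_rfl, pre_self]
      · refine ⟨app ((σ k).symm x) false, (adj_app_true_false ..).2 (by simp), ?_⟩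
        simp [pre_app le_rfl, pre_self]

/-- Every vertex of `G_n` has at most `n` neighbours. -/
lemma exists_neighbors (σ : PermSeq) : ∀ {n : ℕ} (x : Fin n → Bool),
    ∃ N : Finset (Fin n → Bool), N.card ≤ n ∧ ∀ y, (duplicube σ n).Adj x y → y ∈ N
  | 0, _ => ⟨∅, le_rfl, fun _ h => h.elim⟩
  | n + 1, u => by
    classical
    obtain ⟨x, a, rfl⟩ := exists_eq_app u
    obtain ⟨N, hN, h⟩ := exists_neighbors σ x
    refine ⟨insert (app (if a then (σ n).symm x else σ n x) (!a)) (N.image fun y => app y a),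
      (Finset.card_insert_le ..).trans
        (Nat.succ_le_succ (Finset.card_image_le.trans hN)), fun v hv => ?_⟩
    obtain ⟨y, b, rfl⟩ := exists_eq_app v
    by_cases hab : a = b
    · subst hab
      exact Finset.mem_insert_of_mem (Finset.mem_image_of_mem _ (h y ((adj_app_same ..).1 hv)))
    · apply Finset.mem_insert.2
      left
      cases a <;> cases b <;> simp at hab ⊢
      · rw [(adj_app_false_true ..).1 hv]
      · rw [(adj_app_true_false ..).1 hv]; simp

/-! ### Balls, connectedness and deterministic diameter bounds. -/

open Classical in
/-- The closed ball of radius `r` around `x`. -/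
noncomputable def cball {V : Type*} [Fintype V] (G : SimpleGraph V) (x : V) (r : ℕ) : Finset V :=
  {y | G.edist x y ≤ r}

@[simp] lemma mem_cball {V : Type*} [Fintype V] {G : SimpleGraph V} {x y : V} {r : ℕ} :
    y ∈ cball G x r ↔ G.edist x y ≤ r := by
  classical simp [cball]

lemma exists_adj_of_edist_le_succ {V : Type*} {G : SimpleGraph V} {x y : V} {r : ℕ}
    (h : G.edist x y ≤ (r + 1 : ℕ)) : x = y ∨ ∃ z, G.Adj x z ∧ G.edist z y ≤ r := by
  obtain ⟨p, hp⟩ := SimpleGraph.exists_walk_of_edist_ne_top (ne_top_of_le_ne_top (by simp) h)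
  rw [← hp] at h
  cases p with
  | nil => exact Or.inl rfl
  | cons hxz q =>
    refine Or.inr ⟨_, hxz, (SimpleGraph.edist_le q).trans ?_⟩
    simp only [SimpleGraph.Walk.length_cons] at h
    exact_mod_cast Nat.le_of_succ_le_succ (by exact_mod_cast h)

lemma card_cball_le (σ : PermSeq) {n : ℕ} (r : ℕ) (x : Fin n → Bool) :
    (cball (duplicube σ n) x r).card ≤ (n + 1) ^ r := by
  classical
  induction r generalizing x with
  | zero =>
    refine (Finset.card_le_card (t := {x}) fun y hy => ?_).trans (by simp)
    have : (duplicube σ n).edist x y = 0 := by simpa using hy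
    exact Finset.mem_singleton.2 (SimpleGraph.edist_eq_zero_iff.1 this).symm
  | succ r ih =>
    obtain ⟨N, hN, h⟩ := exists_neighbors σ x
    calc _ ≤ ((insert x N).biUnion fun z => cball (duplicube σ n) z r).card := by
          refine Finset.card_le_card fun y hy => ?_
          rw [Finset.mem_biUnion]
          rcases exists_adj_of_edist_le_succ (mem_cball.1 hy) with rfl | ⟨z, hz, hzy⟩
          · exact ⟨x, Finset.mem_insert_self .., by simp⟩
          · exact ⟨z, Finset.mem_insert_of_mem (h z hz), by simpa using hzy⟩
      _ ≤ (insert x N).card * (n + 1) ^ r := Finset.card_biUnion_le_card_mul _ _ _ fun z _ => ih z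
      _ ≤ (n + 1) * (n + 1) ^ r :=
          Nat.mul_le_mul_right _ ((Finset.card_insert_le ..).trans (Nat.succ_le_succ hN))
      _ = _ := by ring

lemma edist_app_le (σ : PermSeq) {n : ℕ} (x y : Fin n → Bool) (a : Bool) :
    (duplicube σ (n + 1)).edist (app x a) (app y a) ≤ (duplicube σ n).edist x y := by
  by_cases h : (duplicube σ n).edist x y = ⊤
  · simp [h]
  · obtain ⟨p, hp⟩ := SimpleGraph.exists_walk_of_edist_ne_top h
    let f : duplicube σ n →g duplicube σ (n + 1) :=
      ⟨fun z => app z a, fun h => (adj_app_same ..).2 h⟩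
    rw [← hp]
    exact (SimpleGraph.edist_le (p.map f)).trans (by simp)

/-- Needed because `diam` takes the default value 0 on a disconnected graph, which would void the
lower bound. -/
lemma duplicube_connected (σ : PermSeq) : ∀ n, (duplicube σ n).Connected
  | 0 => by
    have : Subsingleton (Fin 0 → Bool) := inferInstance
    exact { preconnected := fun x y => by rw [Subsingleton.elim x y] }
  | n + 1 => by
    have ih := duplicube_connected σ n
    have same : ∀ x y a, (duplicube σ (n + 1)).Reachable (app x a) (app y a) := fun x y a => by
      have := edist_app_le σ x y a
      rw [← SimpleGraph.edist_ne_top_iff_reachable]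
      exact ne_top_of_le_ne_top (SimpleGraph.edist_ne_top_iff_reachable.2 (ih.preconnected x y)) this
    have ft : ∀ x y, (duplicube σ (n + 1)).Reachable (app x false) (app y true) := fun x y =>
      (((adj_app_false_true σ x _).2 rfl).reachable).trans (same _ y true)
    refine { preconnected := fun u v => ?_ }
    obtain ⟨x, a, rfl⟩ := exists_eq_app u
    obtain ⟨y, b, rfl⟩ := exists_eq_app v
    cases a <;> cases b
    · exact same ..
    · exact ft ..
    · exact (ft ..).symm
    · exact same ..

lemma two_pow_le_succ_pow_diam (σ : PermSeq) (n : ℕ) :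
    2 ^ n ≤ (n + 1) ^ (duplicube σ n).diam := by
  have hc := duplicube_connected σ n
  have ht := SimpleGraph.connected_iff_ediam_ne_top.1 hc
  have h : cball (duplicube σ n) (fun _ => false) (duplicube σ n).diam = Finset.univ := by
    refine Finset.eq_univ_of_forall fun y => mem_cball.2 ?_
    rw [← (hc.preconnected _ y).coe_dist_eq_edist]
    exact_mod_cast SimpleGraph.dist_le_diam ht
  have := card_cball_le σ (duplicube σ n).diam (fun _ : Fin n => false)
  rw [h] at this
  simpa using this

/-- If `σ n` always joins the balls of radius `r` in `G_n`, then the diameter of `G_{n+1}` is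
at most `2 * r + 2`. -/
lemma diam_succ_le (σ : PermSeq) (n r : ℕ)
    (h : ∀ x y, ∃ z ∈ cball (duplicube σ n) x r, σ n z ∈ cball (duplicube σ n) y r) :
    (duplicube σ (n + 1)).diam ≤ 2 * r + 2 := by
  have key : ∀ x y, (duplicube σ (n + 1)).edist (app x false) (app y true) ≤ (2 * r + 1 : ℕ) := by
    intro x y
    obtain ⟨z, hz, hz'⟩ := h x y
    have h1 := (edist_app_le σ x z false).trans (mem_cball.1 hz)
    have h2 := (edist_app_le σ y (σ n z) true).trans (mem_cball.1 hz')
    rw [SimpleGraph.edist_comm] at h2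
    have h3 := (SimpleGraph.edist_eq_one_iff_adj.2 ((adj_app_false_true σ z _).2 rfl)).le
    refine (SimpleGraph.edist_triangle.trans (add_le_add h1
      (SimpleGraph.edist_triangle.trans (add_le_add h3 h2)))).trans (le_of_eq ?_)
    push_cast; ring
  -- Two vertices in the same copy are reduced to `key` by first crossing the matching from one of
  -- them, at the cost of one more step.
  have step : ∀ u v, (duplicube σ (n + 1)).edist u v ≤ (2 * r + 2 : ℕ) := by
    intro u v
    obtain ⟨x, a, rfl⟩ := exists_eq_app u
    obtain ⟨y, b, rfl⟩ := exists_eq_app v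
    have e : ((2 * r + 2 : ℕ) : ℕ∞) = 1 + (2 * r + 1 : ℕ) := by push_cast; ring
    have l : ((2 * r + 1 : ℕ) : ℕ∞) ≤ (2 * r + 2 : ℕ) := by exact_mod_cast Nat.le_succ _
    cases a <;> cases b
    · have h3 := (SimpleGraph.edist_eq_one_iff_adj.2 ((adj_app_false_true σ x _).2 rfl)).le
      have h4 := key y (σ n x)
      rw [SimpleGraph.edist_comm] at h4
      rw [e]
      exact SimpleGraph.edist_triangle.trans (add_le_add h3 h4)
    · exact (key x y).trans l
    · rw [SimpleGraph.edist_comm]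
      exact (key y x).trans l
    · have h3 := (SimpleGraph.edist_eq_one_iff_adj.2
        ((adj_app_true_false σ x ((σ n).symm x)).2 (by simp))).le
      rw [e]
      exact SimpleGraph.edist_triangle.trans (add_le_add h3 (key _ y))
  exact ENat.toNat_le_of_le_natCast (SimpleGraph.ediam_le_of_edist_le step)

/-! ### Counting permutations that map one set into another. -/

section Perm
variable {V : Type*} [Fintype V] [DecidableEq V]

/-- The permutations that map `A` into `B`. -/
def mapsInto (A B : Finset V) : Finset (Equiv.Perm V) := {s | ∀ x ∈ A, s x ∈ B}

@[simp] lemma mem_mapsInto {A B : Finset V} {s : Equiv.Perm V} :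
    s ∈ mapsInto A B ↔ ∀ x ∈ A, s x ∈ B := by simp [mapsInto]

/-- Composing with the transposition of x and y is a bijection, since it fixes A pointwise. -/
lemma card_mapsInto_insert_eq {A B : Finset V} {x y : V} (hx : x ∉ A) (hy : y ∉ A) :
    (mapsInto (insert x A) B).card = (mapsInto (insert y A) B).card := by
  have key : ∀ x y : V, x ∉ A → y ∉ A → ∀ s ∈ mapsInto (insert x A) B,
      s * Equiv.swap x y ∈ mapsInto (insert y A) B := by
    intro x y hx hy s hs
    simp only [mem_mapsInto, Finset.mem_insert, forall_eq_or_imp] at hs ⊢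
    refine ⟨by simpa using hs.1, fun z hz => ?_⟩
    rw [Equiv.Perm.mul_apply, Equiv.swap_apply_of_ne_of_ne (by grind) (by grind)]
    exact hs.2 z hz
  refine Finset.card_nbij' (fun s => s * Equiv.swap x y) (fun s => s * Equiv.swap x y)
    (fun s hs => key x y hx hy s hs) (fun s hs => ?_) (fun s _ => ?_) (fun s _ => ?_)
  · rw [Equiv.swap_comm]
    exact key y x hy hx s hs
  · simp [mul_assoc]
  · simp [mul_assoc]

/-- Double counting of pairs (s, y) with y ∉ A, s mapping A into B and s y ∈ B. By symmetry each y
contributes equally; each s contributes |B| - |A| points, because A lies in the preimage of B. -/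
lemma card_mapsInto_insert {A B : Finset V} {x : V} (hx : x ∉ A) :
    (Fintype.card V - A.card) * (mapsInto (insert x A) B).card =
      (B.card - A.card) * (mapsInto A B).card := by
  have h1 : ∑ y ∈ Aᶜ, (mapsInto (insert y A) B).card =
      (Fintype.card V - A.card) * (mapsInto (insert x A) B).card := by
    rw [Finset.sum_congr rfl fun y hy =>
      card_mapsInto_insert_eq (B := B) (Finset.mem_compl.1 hy) hx]
    simp [Finset.card_compl]
  rw [← h1]
  have h2 : ∀ y, (mapsInto (insert y A) B).card =
      ∑ s ∈ mapsInto A B, if s y ∈ B then 1 else 0 := by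
    intro y
    rw [← Finset.card_filter]
    congr 1
    ext s
    simp [and_comm]
  simp only [h2]
  rw [Finset.sum_comm, mul_comm, ← smul_eq_mul, ← Finset.sum_const]
  refine Finset.sum_congr rfl fun s hs => ?_
  rw [← Finset.card_filter]
  have hA : A ⊆ B.map s.symm.toEmbedding := fun z hz => by
    simpa [Finset.mem_map_equiv] using mem_mapsInto.1 hs z hz
  rw [← Finset.card_map s.symm.toEmbedding (s := B), ← Finset.card_sdiff_of_subset hA]
  congr 1
  ext z
  simp [Finset.mem_map_equiv, and_comm]

/-- Sampling without replacement is dominated by sampling with replacement: each new point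
contributes a factor (|B| - |A|) / (N - |A|) ≤ |B| / N. -/
lemma card_mapsInto_le (A B : Finset V) :
    (mapsInto A B).card * Fintype.card V ^ A.card ≤
      B.card ^ A.card * (Fintype.card V).factorial := by
  induction A using Finset.induction_on with
  | empty => simp [mapsInto, Fintype.card_perm]
  | insert x A hx ih =>
    have h := card_mapsInto_insert (B := B) hx
    set N := Fintype.card V
    have hlt : A.card < N := by
      have := Finset.card_le_univ (insert x A)
      rw [Finset.card_insert_of_notMem hx] at this
      exact this
    have hB : B.card ≤ N := Finset.card_le_univ B
    have hstep : (mapsInto (insert x A) B).card * N ≤ B.card * (mapsInto A B).card := by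
      refine Nat.le_of_mul_le_mul_left ?_ (Nat.sub_pos_of_lt hlt)
      calc (N - A.card) * ((mapsInto (insert x A) B).card * N)
          = (B.card - A.card) * N * (mapsInto A B).card := by rw [← mul_assoc, h]; ring
        _ ≤ (B.card * (N - A.card)) * (mapsInto A B).card := by
          refine Nat.mul_le_mul_right _ ?_
          rw [Nat.sub_mul, Nat.mul_sub]
          refine Nat.sub_le_sub_left ?_ _
          rw [mul_comm]
          exact Nat.mul_le_mul_left _ hB
        _ = _ := by ring
    rw [Finset.card_insert_of_notMem hx, pow_succ, pow_succ]
    calc _ = ((mapsInto (insert x A) B).card * N) * N ^ A.card := by ring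
      _ ≤ B.card * (mapsInto A B).card * N ^ A.card := Nat.mul_le_mul_right _ hstep
      _ = B.card * ((mapsInto A B).card * N ^ A.card) := by ring
      _ ≤ B.card * (B.card ^ A.card * N.factorial) := Nat.mul_le_mul_left _ ih
      _ = _ := by ring

end Perm

/-! ### The law of the permutations: uniform marginals and independence. -/

/-- The uniform distribution on the permutations of `{0,1}^k`. -/
noncomputable abbrev unif (k : ℕ) : Measure (Equiv.Perm (Fin k → Bool)) :=
  (PMF.uniformOfFintype (Equiv.Perm (Fin k → Bool))).toMeasure

lemma unif_real_coe {k : ℕ} (S : Finset (Equiv.Perm (Fin k → Bool))) :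
    (unif k).real (S : Set (Equiv.Perm (Fin k → Bool))) = S.card / ((2 ^ k).factorial : ℕ) := by
  rw [measureReal_def, PMF.toMeasure_uniformOfFintype_apply _ (MeasurableSet.of_discrete)]
  simp [Fintype.card_perm]

lemma unif_real_mapsTo_le {k : ℕ} (A B : Finset (Fin k → Bool)) :
    (unif k).real {s | ∀ x ∈ A, s x ∈ B} ≤ ((B.card : ℝ) / 2 ^ k) ^ A.card := by
  have h : {s : Equiv.Perm (Fin k → Bool) | ∀ x ∈ A, s x ∈ B} = (mapsInto A B : Set _) := by
    ext; simp
  rw [h, unif_real_coe, div_pow, div_le_div_iff₀ (by exact_mod_cast Nat.factorial_pos _)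
    (by positivity)]
  have := card_mapsInto_le A B
  simp only [Fintype.card_fun, Fintype.card_bool, Fintype.card_fin] at this
  exact_mod_cast this

/-- Inversion preserves the uniform distribution. -/
lemma unif_real_symm_mapsTo_le {k : ℕ} (A B : Finset (Fin k → Bool)) :
    (unif k).real {s | ∀ x ∈ A, s.symm x ∈ B} ≤ ((B.card : ℝ) / 2 ^ k) ^ A.card := by
  have h : {s : Equiv.Perm (Fin k → Bool) | ∀ x ∈ A, s.symm x ∈ B} =
      (((mapsInto A B).map (Equiv.inv _).toEmbedding : Finset _) : Set _) := by
    ext s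
    simp only [Set.mem_ofPred_eq, Finset.coe_map, Set.mem_image, Finset.mem_coe, mem_mapsInto]
    exact ⟨fun h => ⟨s⁻¹, h, by simp⟩, by rintro ⟨t, ht, rfl⟩; exact ht⟩
  refine le_trans (le_of_eq ?_) (unif_real_mapsTo_le A B)
  have h' : {s : Equiv.Perm (Fin k → Bool) | ∀ x ∈ A, s x ∈ B} = (mapsInto A B : Set _) := by
    ext; simp
  rw [h, h', unif_real_coe, unif_real_coe, Finset.card_map]

lemma permLaw_real_pi (s : Finset ℕ) (t : ∀ k, Set (Equiv.Perm (Fin k → Bool))) :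
    permLaw.real {σ | ∀ k ∈ s, σ k ∈ t k} = ∏ k ∈ s, (unif k).real (t k) := by
  have := Measure.infinitePi_pi (fun k => unif k) (s := s) (t := t)
    fun _ _ => MeasurableSet.of_discrete
  have e : {σ : PermSeq | ∀ k ∈ s, σ k ∈ t k} = Set.pi (s : Set ℕ) t := by ext; simp [Set.pi]
  rw [e, measureReal_def, permLaw, this, ENNReal.toReal_prod]
  rfl

lemma sum_prod_unif_real_singleton (n : ℕ) :
    ∑ g : (∀ k : Fin n, Equiv.Perm (Fin (k : ℕ) → Bool)),
      ∏ k : Fin n, (unif k).real {g k} = 1 := by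
  have h := Finset.prod_univ_sum (fun k : Fin n => (Finset.univ : Finset (Equiv.Perm (Fin k → Bool))))
    (fun k s => (unif k).real {s})
  rw [Fintype.piFinset_univ] at h
  rw [← h]
  refine Finset.prod_eq_one fun k _ => ?_
  rw [sum_measureReal_singleton]
  simp

/-- A finite family of permutations, extended by the identity. -/
def extend {n : ℕ} (g : ∀ k : Fin n, Equiv.Perm (Fin (k : ℕ) → Bool)) : PermSeq :=
  fun k => if h : k < n then g ⟨k, h⟩ else 1

lemma extend_coe {n : ℕ} (g : ∀ k : Fin n, Equiv.Perm (Fin (k : ℕ) → Bool)) (k : Fin n) :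
    extend g k = g k := by simp [extend]

lemma permLaw_real_cylinder (n : ℕ) (g : ∀ k : Fin n, Equiv.Perm (Fin (k : ℕ) → Bool))
    (S : Set (Equiv.Perm (Fin n → Bool))) :
    permLaw.real {σ | (∀ k : Fin n, σ k = g k) ∧ σ n ∈ S} =
      (∏ k : Fin n, (unif k).real {g k}) * (unif n).real S := by
  have e : {σ : PermSeq | (∀ k : Fin n, σ k = g k) ∧ σ n ∈ S} =
      {σ | ∀ k ∈ Finset.range (n + 1), σ k ∈ Function.update
        (fun k => ({extend g k} : Set (Equiv.Perm (Fin k → Bool)))) n S k} := by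
    ext σ
    constructor
    · rintro ⟨h, hS⟩ k hk
      rcases Nat.lt_succ_iff_lt_or_eq.1 (Finset.mem_range.1 hk) with h' | rfl
      · rw [Function.update_of_ne h'.ne]
        exact (h ⟨k, h'⟩).trans (extend_coe g ⟨k, h'⟩).symm
      · rwa [Function.update_self]
    · intro h
      refine ⟨fun k => ?_, ?_⟩
      · have := h k (Finset.mem_range.2 (k.2.trans n.lt_succ_self))
        rw [Function.update_of_ne k.2.ne, extend_coe] at this
        exact this
      · have := h n (Finset.self_mem_range_succ n)
        rwa [Function.update_self] at this
  rw [e, permLaw_real_pi, Finset.prod_range_succ, Function.update_self, Finset.prod_range]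
  congr 1
  refine Finset.prod_congr rfl fun k _ => ?_
  rw [Function.update_of_ne k.2.ne, extend_coe]

/-- An event whose conditional probability given `σ_0, …, σ_{n-1}` is at most `p`, because it only
restricts `σ_n`, has probability at most `p`. -/
lemma permLaw_real_le_of_cond (n : ℕ) (E : PermSeq → Set (Equiv.Perm (Fin n → Bool))) {p : ℝ}
    (hE : ∀ σ τ : PermSeq, (∀ k < n, σ k = τ k) → E σ = E τ)
    (hp : ∀ σ, (unif n).real (E σ) ≤ p) : permLaw.real {σ | σ n ∈ E σ} ≤ p := by
  have hsub : {σ | σ n ∈ E σ} ⊆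
      ⋃ g ∈ (Finset.univ : Finset (∀ k : Fin n, Equiv.Perm (Fin (k : ℕ) → Bool))),
        {σ : PermSeq | (∀ k : Fin n, σ k = g k) ∧ σ n ∈ E (extend g)} := by
    intro σ hσ
    refine Set.mem_biUnion (Finset.mem_coe.2 (Finset.mem_univ fun k : Fin n => σ k)) ?_
    refine ⟨fun _ => rfl, ?_⟩
    rw [← hE σ _ fun k hk => (extend_coe (fun k : Fin n => σ k) ⟨k, hk⟩).symm]
    exact hσ
  refine (measureReal_mono hsub (measure_ne_top _ _)).trans
    ((measureReal_biUnion_finset_le _ _).trans ?_)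
  calc _ ≤ ∑ g : (∀ k : Fin n, Equiv.Perm (Fin (k : ℕ) → Bool)),
        (∏ k : Fin n, (unif k).real {g k}) * p := by
        refine Finset.sum_le_sum fun g _ => ?_
        rw [permLaw_real_cylinder]
        exact mul_le_mul_of_nonneg_left (hp _) (Finset.prod_nonneg fun _ _ => measureReal_nonneg)
    _ = p := by rw [← Finset.sum_mul, sum_prod_unif_real_singleton, one_mul]

/-! ### Expansion of sets with distinct prefixes. -/

lemma card_fiber_pre_le {m k : ℕ} (h : m ≤ k) (w : Fin m → Bool) :
    ({z | pre h z = w} : Finset (Fin k → Bool)).card ≤ 2 ^ (k - m) := by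
  have hc : (Finset.univ : Finset (Fin (k - m) → Bool)).card = 2 ^ (k - m) := by simp
  rw [← hc]
  refine Finset.card_le_card_of_injOn (fun z i => z ⟨m + i, by omega⟩) (fun _ _ => by simp) ?_
  intro z hz z' hz' hzz
  simp only [Finset.coe_filter, Finset.mem_univ, true_and] at hz hz'
  funext i
  rcases lt_or_ge (i : ℕ) m with hi | hi
  · exact congrFun (hz.trans hz'.symm) ⟨i, hi⟩
  · have := congrFun hzz ⟨i - m, by omega⟩
    have e : (⟨m + (i - m), by omega⟩ : Fin k) = i := Fin.ext (by simp; omega)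
    simpa only [e] using this

/-- The permutations `s` for which the `k`-th matching sends all vertices `ψ i` to vertices whose
first `m` coordinates are in the range of `φ`. -/
def levelBad {m n f t : ℕ} (ψ : Fin f → Fin n → Bool) (φ : Fin t → Fin m → Bool) (k : ℕ) :
    Set (Equiv.Perm (Fin k → Bool)) :=
  {s | ∀ (h₁ : m ≤ k) (h₂ : k < n) (i : Fin f), pre h₁ (if ψ i ⟨k, h₂⟩ then
    s.symm (pre h₂.le (ψ i)) else s (pre h₂.le (ψ i))) ∈ Set.range φ}

/-- Vertices with k-th bit 0 constrain `s`, the others constrain its inverse, and these constraints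
are dependent. Bounding the probability by each one separately and multiplying the two bounds yields
the full exponent f for the square. -/
lemma unif_real_levelBad_sq_le {m n f t k : ℕ} (ψ : Fin f → Fin n → Bool) (φ : Fin t → Fin m → Bool)
    (h₁ : m ≤ k) (h₂ : k < n)
    (hψ : Function.Injective fun i => pre (h₁.trans h₂.le) (ψ i)) :
    (unif k).real (levelBad ψ φ k) ^ 2 ≤ ((t : ℝ) / 2 ^ m) ^ f := by
  classical
  set B : Finset (Fin k → Bool) := {z | pre h₁ z ∈ Set.range φ} with hB
  have hBc : (B.card : ℝ) / 2 ^ k ≤ t / 2 ^ m := by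
    have hsub : B ⊆ (Finset.univ : Finset (Fin t)).biUnion fun j => {z | pre h₁ z = φ j} := by
      intro z hz
      simp only [hB, Finset.mem_filter, Finset.mem_univ, true_and, Set.mem_range] at hz
      obtain ⟨j, hj⟩ := hz
      simp only [Finset.mem_biUnion, Finset.mem_univ, Finset.mem_filter, true_and]
      exact ⟨j, hj.symm⟩
    have hle : B.card ≤ t * 2 ^ (k - m) := by
      refine (Finset.card_le_card hsub).trans ((Finset.card_biUnion_le_card_mul _ _ _
        fun j _ => card_fiber_pre_le h₁ (φ j)).trans ?_)
      simp
    rw [div_le_div_iff₀ (by positivity) (by positivity)]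
    have : B.card * 2 ^ m ≤ t * 2 ^ k := by
      calc _ ≤ t * 2 ^ (k - m) * 2 ^ m := Nat.mul_le_mul_right _ hle
        _ = t * 2 ^ k := by rw [mul_assoc, ← pow_add, Nat.sub_add_cancel h₁]
    exact_mod_cast this
  have hinj : Function.Injective fun i => pre h₂.le (ψ i) := by
    intro i j hij
    exact hψ (by simpa only [pre_pre] using congrArg (pre h₁) hij)
  let I : Bool → Finset (Fin f) := fun b => {i | ψ i ⟨k, h₂⟩ = b}
  let A : Bool → Finset (Fin k → Bool) := fun b => (I b).image fun i => pre h₂.le (ψ i)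
  have hA : ∀ b, (A b).card = (I b).card := fun b => Finset.card_image_of_injective _ hinj
  have hcard : (A false).card + (A true).card = f := by
    rw [hA, hA]
    have := Finset.card_filter_add_card_filter_not (s := (Finset.univ : Finset (Fin f)))
      (fun i => ψ i ⟨k, h₂⟩ = false)
    simpa [I] using this
  have h0 : (unif k).real (levelBad ψ φ k) ≤ ((t : ℝ) / 2 ^ m) ^ (A false).card := by
    refine ((measureReal_mono ?_ (measure_ne_top _ _)).trans
      (unif_real_mapsTo_le (A false) B)).trans (pow_le_pow_left₀ (by positivity) hBc _)
    intro s hs x hx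
    obtain ⟨i, hi, rfl⟩ := Finset.mem_image.1 hx
    have hi' : ψ i ⟨k, h₂⟩ = false := by simpa [I] using hi
    have := hs h₁ h₂ i
    rw [hi'] at this
    exact Finset.mem_filter.2 ⟨Finset.mem_univ _, this⟩
  have h1 : (unif k).real (levelBad ψ φ k) ≤ ((t : ℝ) / 2 ^ m) ^ (A true).card := by
    refine ((measureReal_mono ?_ (measure_ne_top _ _)).trans
      (unif_real_symm_mapsTo_le (A true) B)).trans (pow_le_pow_left₀ (by positivity) hBc _)
    intro s hs x hx
    obtain ⟨i, hi, rfl⟩ := Finset.mem_image.1 hx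
    have hi' : ψ i ⟨k, h₂⟩ = true := by simpa [I] using hi
    have := hs h₁ h₂ i
    rw [hi'] at this
    exact Finset.mem_filter.2 ⟨Finset.mem_univ _, this⟩
  calc _ = (unif k).real (levelBad ψ φ k) * (unif k).real (levelBad ψ φ k) := sq _
    _ ≤ _ := mul_le_mul h0 h1 measureReal_nonneg (by positivity)
    _ = _ := by rw [← pow_add, hcard]

lemma permLaw_real_levelBad_le {m n f t l : ℕ} (hmn : m ≤ n) (ψ : Fin f → Fin n → Bool)
    (φ : Fin t → Fin m → Bool) (hψ : Function.Injective fun i => pre hmn (ψ i))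
    (htm : t * 2 ^ (2 * l) ≤ 2 ^ m) :
    permLaw.real {σ | ∀ k ∈ Finset.Ico m n, σ k ∈ levelBad ψ φ k} ≤
      (1 / 2) ^ (l * f * (n - m)) := by
  have hp : (t : ℝ) / 2 ^ m ≤ (1 / 2) ^ (2 * l) := by
    rw [div_pow, one_pow, div_le_div_iff₀ (by positivity) (by positivity), one_mul]
    exact_mod_cast htm
  rw [permLaw_real_pi]
  refine (pow_le_pow_iff_left₀ (Finset.prod_nonneg fun _ _ => measureReal_nonneg)
    (by positivity) two_ne_zero).1 ?_
  rw [← Finset.prod_pow]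
  calc _ ≤ ∏ k ∈ Finset.Ico m n, (((1 : ℝ) / 2) ^ (2 * l)) ^ f := by
        refine Finset.prod_le_prod (fun _ _ => sq_nonneg _) fun k hk => ?_
        rw [Finset.mem_Ico] at hk
        exact (unif_real_levelBad_sq_le ψ φ hk.1 hk.2 hψ).trans
          (pow_le_pow_left₀ (by positivity) hp _)
    _ = _ := by
        rw [Finset.prod_const, Nat.card_Ico, ← pow_mul, ← pow_mul, ← pow_mul]
        congr 1
        ring

/-- Some set of `f` vertices with distinct `m`-prefixes has all its neighbours along the matchings
`m, …, n - 1` in at most `t` classes of `m`-prefixes. -/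
def expBad (m n f t : ℕ) (hmn : m ≤ n) : Set PermSeq :=
  {σ | ∃ (ψ : Fin f → Fin n → Bool) (φ : Fin t → Fin m → Bool),
    (Function.Injective fun i => pre hmn (ψ i)) ∧ ∀ k ∈ Finset.Ico m n, σ k ∈ levelBad ψ φ k}

/-- Union bound over 2^(nf) families `ψ` and 2^(mt) lists `φ`. -/
lemma permLaw_real_expBad_le {m n f t l : ℕ} (hmn : m ≤ n) (htm : t * 2 ^ (2 * l) ≤ 2 ^ m) :
    permLaw.real (expBad m n f t hmn) ≤
      2 ^ (n * f) * (2 ^ (m * t) * (1 / 2) ^ (l * f * (n - m))) := by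
  classical
  have hsub : expBad m n f t hmn ⊆ ⋃ ψ ∈ (Finset.univ : Finset (Fin f → Fin n → Bool)),
      ⋃ φ ∈ (Finset.univ : Finset (Fin t → Fin m → Bool)),
      {σ | (Function.Injective fun i => pre hmn (ψ i)) ∧
        ∀ k ∈ Finset.Ico m n, σ k ∈ levelBad ψ φ k} := by
    rintro σ ⟨ψ, φ, h⟩
    simp only [Finset.mem_univ, Set.iUnion_true, Set.mem_iUnion]
    exact ⟨ψ, φ, h⟩
  refine (measureReal_mono hsub (measure_ne_top _ _)).trans
    ((measureReal_biUnion_finset_le _ _).trans ?_)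
  calc _ ≤ ∑ ψ : Fin f → Fin n → Bool, ((2 : ℝ) ^ (m * t) * (1 / 2) ^ (l * f * (n - m))) := by
        refine Finset.sum_le_sum fun ψ _ => (measureReal_biUnion_finset_le _ _).trans ?_
        calc _ ≤ ∑ φ : Fin t → Fin m → Bool, ((1 : ℝ) / 2) ^ (l * f * (n - m)) := by
              refine Finset.sum_le_sum fun φ _ => ?_
              by_cases hψ : Function.Injective fun i => pre hmn (ψ i)
              · simpa only [hψ, true_and] using permLaw_real_levelBad_le hmn ψ φ hψ htm
              · simp only [hψ, false_and]
                simp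
          _ = _ := by simp [pow_mul]
    _ = _ := by simp [pow_mul]

/-- One representative is kept per prefix reached, so the new set again has distinct prefixes and
the step can be iterated. -/
lemma exists_expansion {σ : PermSeq} {m n f t : ℕ} {hmn : m ≤ n} (hσ : σ ∉ expBad m n f t hmn)
    {S : Finset (Fin n → Bool)} (hS : Set.InjOn (pre hmn) S) (hf : S.card = f) :
    ∃ S' : Finset (Fin n → Bool), Set.InjOn (pre hmn) S' ∧ S'.card = t ∧
      ∀ y ∈ S', ∃ x ∈ S, (duplicube σ n).Adj x y := by
  classical
  let W : Finset (Fin m → Bool) := {w | ∃ x ∈ S, ∃ y, (duplicube σ n).Adj x y ∧ pre hmn y = w}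
  have hW : ∀ w, w ∈ W ↔ ∃ x ∈ S, ∃ y, (duplicube σ n).Adj x y ∧ pre hmn y = w := by simp [W]
  rcases le_or_gt t W.card with h | h
  · obtain ⟨W', hW', hc⟩ := Finset.exists_subset_card_eq h
    choose! x hx y hy hp using fun w (hw : w ∈ W') => (hW w).1 (hW' hw)
    refine ⟨W'.image y, ?_, ?_, ?_⟩
    · intro u hu v hv huv
      obtain ⟨a, ha, rfl⟩ := Finset.mem_image.1 hu
      obtain ⟨b, hb, rfl⟩ := Finset.mem_image.1 hv
      rw [hp a ha, hp b hb] at huv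
      rw [huv]
    · rw [Finset.card_image_of_injOn, hc]
      intro a ha b hb hab
      rw [← hp a ha, ← hp b hb]
      exact congrArg _ hab
    · intro u hu
      obtain ⟨a, ha, rfl⟩ := Finset.mem_image.1 hu
      exact ⟨x a, hx a ha, hy a ha⟩
  · exfalso
    let e := S.equivFinOfCardEq hf
    -- If fewer than t prefixes are reached, their list is padded to length t; the padding only
    -- enlarges the range, so `σ` would be bad.
    let φ : Fin t → Fin m → Bool := fun j =>
      if h : (j : ℕ) < W.card then (W.equivFin.symm ⟨j, h⟩ : Fin m → Bool) else fun _ => false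
    have hφ : ∀ w ∈ W, w ∈ Set.range φ := by
      intro w hw
      refine ⟨⟨W.equivFin ⟨w, hw⟩, (Fin.is_lt _).trans h⟩, ?_⟩
      simp [φ]
    refine hσ ⟨fun i => e.symm i, φ, ?_, ?_⟩
    · intro i j hij
      exact e.symm.injective (Subtype.ext (hS (e.symm i).2 (e.symm j).2 hij))
    · intro k _ h₁ h₂ i
      obtain ⟨y, hy, hp⟩ := exists_adj_pre σ h₂ (e.symm i : Fin n → Bool)
      rw [← hp]
      exact hφ _ ((hW _).2 ⟨_, (e.symm i).2, y, hy, rfl⟩)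

lemma pow_le_card_cball {σ : PermSeq} {m n d r : ℕ} {hmn : m ≤ n}
    (hσ : ∀ i < r, σ ∉ expBad m n (d ^ i) (d ^ (i + 1)) hmn) (x : Fin n → Bool) :
    d ^ r ≤ (cball (duplicube σ n) x r).card := by
  have key : ∀ i ≤ r, ∃ S : Finset (Fin n → Bool), Set.InjOn (pre hmn) S ∧ S.card = d ^ i ∧
      S ⊆ cball (duplicube σ n) x i := by
    intro i
    induction i with
    | zero => exact fun _ => ⟨{x}, by simp, by simp, by simp⟩
    | succ i ih =>
      intro hi
      obtain ⟨S, hS, hc, hb⟩ := ih (Nat.le_of_succ_le hi)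
      obtain ⟨S', hS', hc', hadj⟩ := exists_expansion (hσ i hi) hS hc
      refine ⟨S', hS', hc', fun y hy => mem_cball.2 ?_⟩
      obtain ⟨z, hz, hzy⟩ := hadj y hy
      refine (SimpleGraph.edist_triangle.trans (add_le_add (mem_cball.1 (hb hz))
        (SimpleGraph.edist_eq_one_iff_adj.2 hzy).le)).trans ?_
      simp
  obtain ⟨S, _, hc, hb⟩ := key r le_rfl
  rw [← hc]
  exact Finset.card_le_card hb

/-! ### Joining two large balls. -/

/-- The permutations that do not join some two balls of radius `r` and size at least `a`. -/
def joinBad (n r a : ℕ) (σ : PermSeq) : Set (Equiv.Perm (Fin n → Bool)) :=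
  {s | ∃ x y, a ≤ (cball (duplicube σ n) x r).card ∧ a ≤ (cball (duplicube σ n) y r).card ∧
    ∀ z ∈ cball (duplicube σ n) x r, s z ∉ cball (duplicube σ n) y r}

/-- Mapping A into the complement of B has probability at most (1 - a/2^n)^a, and 1 - u ≤ exp(-u).
-/
lemma unif_real_disjoint_le {n a : ℕ} {A B : Finset (Fin n → Bool)} (hA : a ≤ A.card)
    (hB : a ≤ B.card) :
    (unif n).real {s | ∀ z ∈ A, s z ∉ B} ≤ Real.exp (-((a : ℝ) ^ 2 / 2 ^ n)) := by
  classical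
  have e : {s : Equiv.Perm (Fin n → Bool) | ∀ z ∈ A, s z ∉ B} = {s | ∀ z ∈ A, s z ∈ Bᶜ} := by
    simp
  rw [e]
  refine (unif_real_mapsTo_le A Bᶜ).trans ?_
  have h1 : ((Bᶜ.card : ℕ) : ℝ) / 2 ^ n ≤ Real.exp (-((a : ℝ) / 2 ^ n)) := by
    have hc : ((Bᶜ.card : ℕ) : ℝ) = 2 ^ n - B.card := by
      have := Finset.card_compl_add_card B
      simp only [Fintype.card_fun, Fintype.card_bool, Fintype.card_fin] at this
      rw [eq_sub_iff_add_eq]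
      exact_mod_cast this
    have hB' : (a : ℝ) ≤ B.card := by exact_mod_cast hB
    rw [hc, sub_div, div_self (by positivity)]
    have := Real.add_one_le_exp (-((a : ℝ) / 2 ^ n))
    have : (a : ℝ) / 2 ^ n ≤ B.card / 2 ^ n := by gcongr
    linarith
  calc _ ≤ Real.exp (-((a : ℝ) / 2 ^ n)) ^ A.card := pow_le_pow_left₀ (by positivity) h1 _
    _ ≤ Real.exp (-((a : ℝ) / 2 ^ n)) ^ a :=
        pow_le_pow_of_le_one (Real.exp_nonneg _)
          (Real.exp_le_one_iff.2 (neg_nonpos.2 (by positivity))) hA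
    _ = _ := by
        rw [← Real.exp_nat_mul]
        congr 1
        ring

lemma permLaw_real_joinBad_le (n r a : ℕ) :
    permLaw.real {σ | σ n ∈ joinBad n r a σ} ≤ 4 ^ n * Real.exp (-((a : ℝ) ^ 2 / 2 ^ n)) := by
  classical
  refine permLaw_real_le_of_cond n (joinBad n r a) (fun σ τ h => ?_) fun σ => ?_
  -- The balls of G_n depend only on the permutations below level n.
  · simp only [joinBad, duplicube_congr h]
  have hsub : joinBad n r a σ ⊆ ⋃ p ∈ (Finset.univ : Finset ((Fin n → Bool) × (Fin n → Bool))),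
      {s | a ≤ (cball (duplicube σ n) p.1 r).card ∧ a ≤ (cball (duplicube σ n) p.2 r).card ∧
        ∀ z ∈ cball (duplicube σ n) p.1 r, s z ∉ cball (duplicube σ n) p.2 r} := by
    rintro s ⟨x, y, h⟩
    exact Set.mem_biUnion (Finset.mem_coe.2 (Finset.mem_univ (x, y))) h
  refine (measureReal_mono hsub (measure_ne_top _ _)).trans
    ((measureReal_biUnion_finset_le _ _).trans ?_)
  calc _ ≤ ∑ p : (Fin n → Bool) × (Fin n → Bool), Real.exp (-((a : ℝ) ^ 2 / 2 ^ n)) := by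
        refine Finset.sum_le_sum fun p _ => ?_
        by_cases h1 : a ≤ (cball (duplicube σ n) p.1 r).card
        · by_cases h2 : a ≤ (cball (duplicube σ n) p.2 r).card
          · simpa only [h1, h2, true_and] using unif_real_disjoint_le h1 h2
          · simp only [h2, false_and, and_false]
            simpa using Real.exp_nonneg _
        · simp only [h1, false_and]
          simpa using Real.exp_nonneg _
    _ = _ := by
        simp only [Finset.sum_const, Finset.card_univ, Fintype.card_prod, Fintype.card_fun,
          Fintype.card_bool, Fintype.card_fin, nsmul_eq_mul]
        rw [← mul_pow]
        norm_num

/-! ### Choice of parameters and failure probability. -/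

lemma two_pow_mul_half_pow_le {x y z w : ℕ} (h : x + y + w ≤ z) :
    (2 : ℝ) ^ x * (2 ^ y * (1 / 2) ^ z) ≤ (1 / 2) ^ w := by
  rw [← mul_assoc, ← pow_add, one_div, inv_pow, inv_pow, ← div_eq_mul_inv, ← one_div,
    div_le_div_iff₀ (by positivity) (by positivity), one_mul, ← pow_add]
  exact pow_le_pow_right₀ one_le_two h

/-- The growth factor per step in the exploration of `G_n`. -/
def growth (n : ℕ) : ℕ := n / 64

/-- The ball size that guarantees that `σ_n` joins any two balls. -/
def target (n : ℕ) : ℕ := n * 2 ^ (n / 2 + 1)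

/-- The radius at which balls of `G_n` have reached the target size. -/
def radius (n : ℕ) : ℕ := Nat.clog (growth n) (target n)

lemma prefixLength_le (n : ℕ) : 48 * growth n ≤ n := by unfold growth; omega

/-- With d = `growth n`, the power of two contributes at most 32d + 33 to the exponent and the
factor n at most d - 33. -/
lemma target_le {n : ℕ} (hn : 65536 ≤ n) : target n ≤ 2 ^ (33 * growth n) := by
  have key : ∀ e : ℕ, 67 ≤ e → 64 * e + 2176 ≤ 2 ^ e := by
    intro e he
    induction e, he using Nat.le_induction with
    | base => norm_num
    | succ e he ih => rw [pow_succ]; omega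
  have hd : 1000 ≤ growth n := by unfold growth; omega
  have h1 : n ≤ 2 ^ (growth n - 33) :=
    le_trans (by unfold growth at *; omega) (key (growth n - 33) (by omega))
  calc n * 2 ^ (n / 2 + 1) ≤ 2 ^ (growth n - 33) * 2 ^ (32 * growth n + 33) :=
        Nat.mul_le_mul h1 (Nat.pow_le_pow_right two_pos (by unfold growth; omega))
    _ = 2 ^ (33 * growth n) := by rw [← pow_add]; congr 1; omega

lemma pow_growth_lt_target {n i : ℕ} (hn : 65536 ≤ n) (hi : i < radius n) :
    growth n ^ i < target n :=
  (Nat.lt_clog_iff_pow_lt (by unfold growth; omega)).1 hi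

lemma target_le_pow_radius {n : ℕ} (hn : 65536 ≤ n) : target n ≤ growth n ^ radius n :=
  Nat.le_pow_clog (by unfold growth; omega) _

lemma radius_le {n : ℕ} (hn : 65536 ≤ n) : radius n ≤ 33 * growth n :=
  (Nat.clog_anti_left one_lt_two (by unfold growth; omega)).trans
    (Nat.clog_le_of_le_pow (target_le hn))

lemma permLaw_real_expBad_growth_le {n i : ℕ} (hn : 65536 ≤ n) (hi : i < radius n) :
    permLaw.real (expBad (48 * growth n) n (growth n ^ i) (growth n ^ (i + 1))
      (prefixLength_le n)) ≤ (1 / 2) ^ (32 * growth n ^ 2) := by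
  have hd : 1000 ≤ growth n := by unfold growth; omega
  have hn' : n ≤ 65 * growth n := by unfold growth at *; omega
  have hn'' : 64 * growth n ≤ n := by unfold growth; omega
  have hf : growth n ^ i ≤ 2 ^ (33 * growth n) :=
    (pow_growth_lt_target hn hi).le.trans (target_le hn)
  have hf1 : 1 ≤ growth n ^ i := Nat.one_le_pow _ _ (by omega)
  refine (permLaw_real_expBad_le (l := 7 * growth n) _ ?_).trans (two_pow_mul_half_pow_le ?_)
  -- Exponents: 33d for f, d for the factor d, and 14d for 2l, in total exactly m = 48d.
  · calc _ = growth n ^ i * growth n * 2 ^ (2 * (7 * growth n)) := by rw [pow_succ]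
      _ ≤ 2 ^ (33 * growth n) * 2 ^ growth n * 2 ^ (2 * (7 * growth n)) :=
        Nat.mul_le_mul_right _ (Nat.mul_le_mul hf Nat.lt_two_pow_self.le)
      _ = _ := by rw [← pow_add, ← pow_add]; congr 1; omega
  -- The gain is at least 7d·f·16d = 112d²f. It pays 48d²f for the lists, at most 32d²f for the
  -- vertex families (as 65 ≤ 32d), and 32d² for the claimed bound.
  · rw [pow_succ]
    generalize growth n ^ i = f at *
    generalize growth n = d at *
    have h16 : 16 * d ≤ n - 48 * d := by omega
    have h65 : 65 * (d * f) ≤ 32 * d * (d * f) := Nat.mul_le_mul_right _ (by omega)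
    have h32 : 32 * d ^ 2 ≤ 32 * d ^ 2 * f := Nat.le_mul_of_pos_right _ hf1
    have hnf : n * f ≤ 65 * d * f := Nat.mul_le_mul_right _ hn'
    calc n * f + 48 * d * (f * d) + 32 * d ^ 2 ≤ 7 * d * f * (16 * d) := by nlinarith
      _ ≤ _ := Nat.mul_le_mul_left _ h16

lemma permLaw_real_joinBad_target_le {n : ℕ} (hn : 65536 ≤ n) (r : ℕ) :
    permLaw.real {σ | σ n ∈ joinBad n r (target n) σ} ≤ (1 / 2) ^ (2 * n + 3) := by
  refine (permLaw_real_joinBad_le n r _).trans ?_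
  have h1 : (2 : ℝ) * n ^ 2 ≤ (target n : ℝ) ^ 2 / 2 ^ n := by
    rw [le_div_iff₀ (by positivity)]
    have : 2 * n ^ 2 * 2 ^ n ≤ target n ^ 2 := by
      calc 2 * n ^ 2 * 2 ^ n = n ^ 2 * 2 ^ (n + 1) := by ring
        _ ≤ n ^ 2 * 2 ^ ((n / 2 + 1) * 2) :=
          Nat.mul_le_mul_left _ (Nat.pow_le_pow_right two_pos (by omega))
        _ = _ := by rw [target, mul_pow, ← pow_mul]
    exact_mod_cast this
  have h2 : Real.exp (-((target n : ℝ) ^ 2 / 2 ^ n)) ≤ (1 / 2) ^ (2 * n ^ 2) := by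
    calc _ ≤ Real.exp (((2 * n ^ 2 : ℕ) : ℝ) * (-1)) :=
          Real.exp_le_exp.2 (by push_cast; linarith)
      _ = Real.exp (-1) ^ (2 * n ^ 2) := Real.exp_nat_mul _ _
      _ ≤ _ := by
          refine pow_le_pow_left₀ (Real.exp_nonneg _) ?_ _
          have := Real.add_one_le_exp (1 : ℝ)
          rw [Real.exp_neg, one_div]
          exact inv_anti₀ two_pos (by linarith)
  calc _ ≤ (4 : ℝ) ^ n * (1 / 2) ^ (2 * n ^ 2) := by gcongr
    _ = 2 ^ (2 * n) * (2 ^ 0 * (1 / 2) ^ (2 * n ^ 2)) := by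
      rw [pow_mul 2 2 n]; norm_num
    _ ≤ _ := two_pow_mul_half_pow_le (by nlinarith)

lemma permLaw_real_diam_gt_le {n : ℕ} (hn : 65536 ≤ n) :
    permLaw.real {σ | 2 * radius n + 2 < (duplicube σ (n + 1)).diam} ≤ (1 / 4) ^ (n + 1) := by
  have hd : 1000 ≤ growth n := by unfold growth; omega
  have hn' : n ≤ 65 * growth n := by unfold growth at *; omega
  have hsub : {σ | 2 * radius n + 2 < (duplicube σ (n + 1)).diam} ⊆
      (⋃ i ∈ Finset.range (radius n), expBad (48 * growth n) n (growth n ^ i) (growth n ^ (i + 1))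
        (prefixLength_le n)) ∪ {σ | σ n ∈ joinBad n (radius n) (target n) σ} := by
    intro σ hσ
    by_contra hcon
    simp only [Set.mem_union, Set.mem_iUnion, Finset.mem_range, not_or, not_exists] at hcon
    have hball : ∀ x, target n ≤ (cball (duplicube σ n) x (radius n)).card := fun x =>
      (target_le_pow_radius hn).trans (pow_le_card_cball (fun i hi => hcon.1 i hi) x)
    refine not_le_of_gt hσ (diam_succ_le σ n (radius n) fun x y => ?_)
    by_contra h
    push Not at h
    exact hcon.2 ⟨x, y, hball x, hball y, h⟩
  refine (measureReal_mono hsub (measure_ne_top _ _)).trans ((measureReal_union_le _ _).trans ?_)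
  have h1 : permLaw.real (⋃ i ∈ Finset.range (radius n), expBad (48 * growth n) n (growth n ^ i)
      (growth n ^ (i + 1)) (prefixLength_le n)) ≤ (1 / 2) ^ (2 * n + 3) := by
    refine (measureReal_biUnion_finset_le _ _).trans ?_
    calc _ ≤ ∑ i ∈ Finset.range (radius n), ((1 : ℝ) / 2) ^ (32 * growth n ^ 2) :=
          Finset.sum_le_sum fun i hi =>
            permLaw_real_expBad_growth_le hn (Finset.mem_range.1 hi)
      _ = radius n * (1 / 2) ^ (32 * growth n ^ 2) := by simp
      _ ≤ 2 ^ (33 * growth n) * (2 ^ 0 * (1 / 2) ^ (32 * growth n ^ 2)) := by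
          rw [pow_zero, one_mul]
          gcongr
          exact_mod_cast (radius_le hn).trans Nat.lt_two_pow_self.le
      _ ≤ _ := two_pow_mul_half_pow_le (by nlinarith)
  have h2 := permLaw_real_joinBad_target_le hn (radius n)
  calc _ ≤ ((1 : ℝ) / 2) ^ (2 * n + 3) + (1 / 2) ^ (2 * n + 3) := add_le_add h1 h2
    _ = (1 / 4) ^ (n + 1) := by
      rw [show (1 / 4 : ℝ) = (1 / 2) ^ 2 by norm_num, ← pow_mul]
      ring

/-! ### Asymptotics of the radius and conclusion. -/

lemma log_sq_le {x : ℝ} (h : 1 ≤ x) : Real.log x ^ 2 ≤ 4 * x := by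
  have hx : 0 < x := one_pos.trans_le h
  have h1 : 0 ≤ Real.log x := Real.log_nonneg h
  have h2 : Real.log x ≤ 2 * √x := by
    have := Real.log_le_sub_one_of_pos (Real.sqrt_pos.2 hx)
    rw [Real.log_sqrt hx.le] at this
    linarith
  calc _ ≤ (2 * √x) ^ 2 := pow_le_pow_left₀ h1 h2 2
    _ = _ := by rw [mul_pow, Real.sq_sqrt hx.le]; norm_num

lemma log_le_logb_two {x : ℝ} (hx : 1 ≤ x) : Real.log x ≤ Real.logb 2 x := by
  rw [Real.logb, le_div_iff₀ (Real.log_pos one_lt_two)]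
  have := Real.log_two_lt_d9
  nlinarith [Real.log_nonneg hx]

/-- By minimality of the radius r, d^(r-1) is below the target. Taking logarithms with d ≥ X/2^8
gives (r-1)(L-8) ≤ L + X/2 + 1/2, and replacing L - 8 by L costs O(X/L²). -/
lemma radius_bound {n : ℕ} (hn : 65536 ≤ n) :
    ((2 * radius n + 2 : ℕ) : ℝ) ≤ ((n + 1 : ℕ) : ℝ) / Real.logb 2 (n + 1 : ℕ) +
      60 * (((n + 1 : ℕ) : ℝ) / Real.log (n + 1 : ℕ) ^ 2) := by
  have hd : 1000 ≤ growth n := by unfold growth; omega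
  have hr : 1 ≤ radius n := by
    refine Nat.one_le_iff_ne_zero.2 fun h => ?_
    have h1 := target_le_pow_radius hn
    rw [h, pow_zero] at h1
    have : n * 1 ≤ target n := Nat.mul_le_mul_left _ Nat.one_le_two_pow
    omega
  have hpow := pow_growth_lt_target hn (Nat.sub_lt hr one_pos)
  set X : ℝ := ((n + 1 : ℕ) : ℝ) with hX
  set L := Real.logb 2 X with hL
  have hnX : (n : ℝ) = X - 1 := by rw [hX]; push_cast; ring
  have hX0 : (65537 : ℝ) ≤ X := by rw [hX]; exact_mod_cast Nat.succ_le_succ hn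
  have hXpos : 0 < X := by linarith
  have hL16 : 16 ≤ L := by
    rw [hL, Real.le_logb_iff_rpow_le one_lt_two hXpos]
    norm_num
    linarith
  have hdX : X / 2 ^ 8 ≤ growth n := by
    have : n + 1 ≤ 256 * growth n := by unfold growth; omega
    have : X ≤ 256 * growth n := by rw [hX]; exact_mod_cast this
    rw [div_le_iff₀ (by positivity)]
    linarith
  have hdL : L - 8 ≤ Real.logb 2 (growth n) := by
    have := Real.logb_le_logb_of_le one_lt_two (by positivity) hdX
    rw [Real.logb_div hXpos.ne' (by positivity), Real.logb_pow,
      Real.logb_self_eq_one one_lt_two] at this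
    norm_num at this
    linarith
  have hr' : ((radius n : ℝ) - 1) * (L - 8) ≤ L + X / 2 + 1 / 2 := by
    have hd0 : (0 : ℝ) < growth n := by exact_mod_cast (by omega : 0 < growth n)
    have hn0 : (0 : ℝ) < n := by linarith
    have h1 : ((growth n : ℝ)) ^ (radius n - 1) ≤ n * 2 ^ (n / 2 + 1) := by
      exact_mod_cast hpow.le
    have h2 := Real.logb_le_logb_of_le one_lt_two (by positivity) h1
    rw [Real.logb_pow, Real.logb_mul hn0.ne' (by positivity), Real.logb_pow,
      Real.logb_self_eq_one one_lt_two, Nat.cast_sub hr, Nat.cast_one, mul_one] at h2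
    have h3 : Real.logb 2 n ≤ L := Real.logb_le_logb_of_le one_lt_two hn0 (by linarith)
    have h4 : ((n / 2 + 1 : ℕ) : ℝ) ≤ X / 2 + 1 / 2 := by
      have : ((n / 2 : ℕ) : ℝ) ≤ n / 2 := Nat.cast_div_le
      push_cast
      linarith
    have h5 : (0 : ℝ) ≤ (radius n : ℝ) - 1 := by
      have : (1 : ℝ) ≤ radius n := by exact_mod_cast hr
      linarith
    have := mul_le_mul_of_nonneg_left hdL h5
    linarith
  have hl : Real.log X ≤ L := log_le_logb_two (by linarith)
  have hl0 : 0 < Real.log X := Real.log_pos (by linarith)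
  have hl1 : 1 ≤ 4 * (X / Real.log X ^ 2) := by
    rw [← mul_div_assoc, le_div_iff₀ (by positivity), one_mul]
    exact log_sq_le (by linarith)
  have hXL : X / L ^ 2 ≤ X / Real.log X ^ 2 := by gcongr
  have hmain : 2 * ((radius n : ℝ) - 1) ≤ X / L + 16 * (X / L ^ 2) + 7 := by
    have hLp : 0 < L := by linarith
    have e : (X / L + 16 * (X / L ^ 2) + 7) * (L - 8) =
        X + (8 * X / L - 128 * X / L ^ 2) + 7 * (L - 8) := by
      field_simp
      ring
    -- This is where L ≥ 16, that is n ≥ 2^16, is used: the coefficient 16 covers the loss from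
    -- dividing by L - 8.
    have h6 : 0 ≤ 8 * X / L - 128 * X / L ^ 2 := by
      have : 8 * X / L - 128 * X / L ^ 2 = 8 * X * (L - 16) / L ^ 2 := by
        field_simp
        ring
      rw [this]
      have : 0 ≤ L - 16 := by linarith
      positivity
    refine le_of_mul_le_mul_right ?_ (by linarith : 0 < L - 8)
    rw [e]
    nlinarith
  -- The additive constant is 7 + 4 = 11; by `hl1` it costs 44 units of X / log² X, and 16 + 44 =
  -- 60.
  push_cast
  linarith

lemma diam_lower_bound (σ : PermSeq) {n : ℕ} (hn : 3 ≤ n) :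
    (n : ℝ) / Real.logb 2 n - (n : ℝ) / Real.log n ^ 2 ≤ ((duplicube σ n).diam : ℝ) := by
  set D : ℝ := ((duplicube σ n).diam : ℝ)
  set L := Real.logb 2 n with hL
  have hn0 : (3 : ℝ) ≤ n := by exact_mod_cast hn
  have hl : Real.log n ≤ L := log_le_logb_two (by linarith)
  have hl0 : 0 < Real.log n := Real.log_pos (by linarith)
  have hLp : 0 < L := hl0.trans_le hl
  have h1 : (2 : ℝ) ^ n ≤ (n + 1) ^ (duplicube σ n).diam := by
    exact_mod_cast two_pow_le_succ_pow_diam σ n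
  have h2 := Real.logb_le_logb_of_le one_lt_two (by positivity) h1
  rw [Real.logb_pow, Real.logb_pow, Real.logb_self_eq_one one_lt_two, mul_one] at h2
  -- Using n + 1 ≤ 2n replaces log₂(n+1) by L + 1, which loses at most n/L² in the quotient.
  have h3 : Real.logb 2 (n + 1) ≤ L + 1 := by
    have : Real.logb 2 (n + 1) ≤ Real.logb 2 (n * 2) :=
      Real.logb_le_logb_of_le one_lt_two (by positivity) (by linarith)
    rwa [Real.logb_mul (by positivity) two_ne_zero, Real.logb_self_eq_one one_lt_two] at this
  have h4 : (n : ℝ) ≤ D * (L + 1) :=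
    h2.trans (mul_le_mul_of_nonneg_left h3 (Nat.cast_nonneg _))
  have h5 : (n : ℝ) / (L + 1) ≤ D := by rwa [div_le_iff₀ (by linarith)]
  have h6 : (n : ℝ) / L - n / (L + 1) ≤ n / L ^ 2 := by
    have : (n : ℝ) / L - n / (L + 1) = n / (L * (L + 1)) := by field_simp; ring
    rw [this]
    gcongr
    nlinarith
  have h7 : (n : ℝ) / L ^ 2 ≤ n / Real.log n ^ 2 := by gcongr
  linarith

lemma one_sub_le_permLaw_real {n : ℕ} (hn : 65536 ≤ n) :
    1 - (1 / 4) ^ (n + 1) ≤ permLaw.real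
      {σ | |((duplicube σ (n + 1)).diam : ℝ) - ((n + 1 : ℕ) : ℝ) / Real.logb 2 (n + 1 : ℕ)| ≤
        60 * (((n + 1 : ℕ) : ℝ) / Real.log (n + 1 : ℕ) ^ 2)} := by
  set S := {σ | |((duplicube σ (n + 1)).diam : ℝ) - ((n + 1 : ℕ) : ℝ) / Real.logb 2 (n + 1 : ℕ)| ≤
        60 * (((n + 1 : ℕ) : ℝ) / Real.log (n + 1 : ℕ) ^ 2)}
  have hsub : Set.univ ⊆ S ∪ {σ | 2 * radius n + 2 < (duplicube σ (n + 1)).diam} := by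
    intro σ _
    by_cases h : 2 * radius n + 2 < (duplicube σ (n + 1)).diam
    · exact Or.inr h
    · left
      have h1 : ((duplicube σ (n + 1)).diam : ℝ) ≤ (2 * radius n + 2 : ℕ) := by
        exact_mod_cast not_lt.1 h
      have h2 := radius_bound hn
      have h3 := diam_lower_bound σ (n := n + 1) (by omega)
      have h4 : 0 ≤ ((n + 1 : ℕ) : ℝ) / Real.log (n + 1 : ℕ) ^ 2 := by positivity
      have h5 : |((duplicube σ (n + 1)).diam : ℝ) - ((n + 1 : ℕ) : ℝ) / Real.logb 2 (n + 1 : ℕ)| ≤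
          60 * (((n + 1 : ℕ) : ℝ) / Real.log (n + 1 : ℕ) ^ 2) :=
        abs_le.2 ⟨by linarith, by linarith⟩
      exact h5
  have h1 := (measureReal_mono hsub (measure_ne_top permLaw _)).trans (measureReal_union_le _ _)
  rw [probReal_univ] at h1
  linarith [permLaw_real_diam_gt_le hn]

/-- This is the error sequence of the theorem; the value 1 for small n makes the probability bound
trivial there. -/
lemma quarter_pow_isLittleO :
    (fun n : ℕ => if n ≤ 65536 then (1 : ℝ) else (1 / 4) ^ n) =o[atTop]
      fun n : ℕ => ((2 : ℝ) ^ n)⁻¹ := by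
  have h : (fun n : ℕ => ((1 : ℝ) / 4) ^ n) =o[atTop] fun n : ℕ => ((2 : ℝ)⁻¹) ^ n :=
    isLittleO_pow_pow_of_lt_left (by norm_num) (by norm_num)
  simp only [inv_pow] at h
  refine h.congr' ?_ EventuallyEq.rfl
  filter_upwards [eventually_gt_atTop 65536] with n hn
  rw [if_neg (not_le.2 hn)]

end Duplicube

theorem mainTheorem4 :
    ∃ C : ℝ, ∃ ε : ℕ → ℝ, ε =o[atTop] (fun n : ℕ => ((2 : ℝ) ^ n)⁻¹) ∧
      ∀ n : ℕ, 2 ≤ n →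
        1 - ε n ≤ Duplicube.permLaw.real
          {σ | |((Duplicube.duplicube σ n).diam : ℝ) - (n : ℝ) / Real.logb 2 n| ≤
            C * ((n : ℝ) / Real.log n ^ 2)} := by
  refine ⟨60, _, Duplicube.quarter_pow_isLittleO, fun n _ => ?_⟩
  by_cases h : n ≤ 65536
  · simp only [if_pos h, sub_self]
    exact measureReal_nonneg
  · obtain ⟨k, rfl⟩ : ∃ k, n = k + 1 := ⟨n - 1, by omega⟩
    simp only [if_neg h]
    exact Duplicube.one_sub_le_permLaw_real (by omega)
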